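/- Consider the following two-player communication problem, two-dimensional linear programming with $n$ constraints. An instance is a linear program $\min_{x\in\mathbb{R}^2} c_1x_1+c_2x_2$ subject to $a^j_1x_1+a^j_2x_2\le b^j$ for $j\in\{1,\dots,n\}$, which has an optimal solution. Alice and Bob both know the objective $c$, and the $n$ constraints are partitioned arbitrarily between them. In an $r$-round protocol the players alternately send $r$ messages, each a (possibly empty) bit string depending on the sender's input, the random string and the previous messages; the last message goes from Alice to Bob, so that Alice starts if $r$ is odd and Bob starts if $r$ is even. After that Bob outputs a point of $\mathbb{R}^2$. Protocols may be randomized, with public coins; a protocol solves the problem if on every instance Bob's output is an optimal solution with probability at least $2/3$. Its communication cost is the maximum, over all instances and all random strings, of the total number of bits sent. There are absolute constants $\alpha>0$ and $K\in\mathbb{N}$ such that for all integers $r\ge 1$ and $n\ge 0$, every $r$-round protocol for two-dimensional linear programming with $n$ constraints has communication cost at least $$\alpha\cdot\frac{n^{1/r}}{r^2}.$$ This holds even if the protocol is only required to be correct, and its cost is only measured, on those instances in which all the coefficients $c_i, a^j_i, b^j$ are integers of absolute value at most $n^{Kr}$. -/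

import Mathlib

open MeasureTheory

/-! ## Two-party communication -/

/-- A deterministic two-party protocol. Alice holds `x : X`, Bob holds `y : Y`. A message is a
bit string (possibly empty); it depends on the sender's input and on the list of all messages
sent so far. At the end Bob outputs an element of `Z`. -/
structure DetProtocol (X Y Z : Type*) where
  alice : X → List (List Bool) → List Bool
  bob : Y → List (List Bool) → List Bool
  out : Y → List (List Bool) → Z

namespace DetProtocol

variable {X Y Z : Type*}

/-- The first `i` messages in an execution with `r` rounds on input `(x, y)`. The players
alternate and the last of the `r` messages goes from Alice to Bob; so the message that follows
the first `i` ones is Alice's exactly if `r - i` is odd (Alice starts if `r` is odd, Bob starts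
if `r` is even). -/
def transcript (P : DetProtocol X Y Z) (r : ℕ) (x : X) (y : Y) : ℕ → List (List Bool)
  | 0 => []
  | i + 1 => P.transcript r x y i ++
      [if (r - i) % 2 = 1 then P.alice x (P.transcript r x y i)
        else P.bob y (P.transcript r x y i)]

/-- Bob's answer after `r` rounds. -/
def output (P : DetProtocol X Y Z) (r : ℕ) (x : X) (y : Y) : Z :=
  P.out y (P.transcript r x y r)

/-- The total number of bits sent in the `r` rounds. -/
def cost (P : DetProtocol X Y Z) (r : ℕ) (x : X) (y : Y) : ℕ :=
  ((P.transcript r x y r).map List.length).sum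

end DetProtocol

/-- A two-party promise problem: the promise on the input pairs, and the set of correct answers
for each input pair. -/
structure CommProblem (X Y Z : Type*) where
  valid : X → Y → Prop
  correct : X → Y → Z → Prop

section RandomizedProtocols

variable {X Y Z Ω : Type*} [MeasurableSpace Ω]

/-- A randomized `r`-round protocol is a family `P` of deterministic protocols indexed by the
random string `ω`, which is drawn from a probability measure `μ` and visible to both players
(private coins are the case where `ω` has two independent parts and each player ignores the
part of the other). It solves a problem if on every valid input Bob's answer is correct with
probability at least `2/3`. The event `E` makes this meaningful without any measurability
assumption on `P`: if the event of a correct answer is measurable, the condition says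
that its probability is at least `2/3`. -/
def SolvesWithRounds (μ : Measure Ω) (P : Ω → DetProtocol X Y Z) (r : ℕ)
    (Q : CommProblem X Y Z) : Prop :=
  ∀ x y, Q.valid x y → ∃ E : Set Ω, MeasurableSet E ∧ 2 / 3 ≤ μ E ∧
    ∀ ω ∈ E, Q.correct x y ((P ω).output r x y)

/-- On every valid input and every random string at most `C` bits are sent. -/
def CostAtMost (P : Ω → DetProtocol X Y Z) (r : ℕ) (Q : CommProblem X Y Z) (C : ℕ) : Prop :=
  ∀ x y, Q.valid x y → ∀ ω, (P ω).cost r x y ≤ C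

end RandomizedProtocols

/-! ## Linear programming -/

/-- The constraint `∑ i, a i * x i ≤ b` on `x ∈ ℝ^d`. -/
structure LinConstraint (d : ℕ) where
  a : Fin d → ℝ
  b : ℝ

/-- `x` satisfies all the constraints in `S`. -/
def LPFeasible {d : ℕ} (S : List (LinConstraint d)) (x : Fin d → ℝ) : Prop :=
  ∀ s ∈ S, ∑ i, s.a i * x i ≤ s.b

/-- `x` is an optimal solution of: minimize `∑ i, c i * x i` subject to the constraints in `S`. -/
def LPOptimal {d : ℕ} (c : Fin d → ℝ) (S : List (LinConstraint d)) (x : Fin d → ℝ) : Prop :=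
  LPFeasible S x ∧ ∀ y, LPFeasible S y → ∑ i, c i * x i ≤ ∑ i, c i * y i

/-- `t` is an integer of absolute value at most `M`. -/
def IsIntOfSize (M : ℕ) (t : ℝ) : Prop :=
  ∃ z : ℤ, t = z ∧ |z| ≤ M

/-- The input of one player: the objective vector and the constraints that the player holds. -/
abbrev LPInput (d : ℕ) : Type := (Fin d → ℝ) × List (LinConstraint d)

/-- Two-player linear programming in dimension `d` with `n` constraints. Both players know the
objective, the `n` constraints are partitioned between them, all coefficients are integers of
absolute value at most `M`, and the linear program has an optimal solution. An answer is correct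
if it is an optimal solution. -/
def lpProblem (d n M : ℕ) : CommProblem (LPInput d) (LPInput d) (Fin d → ℝ) where
  valid x y :=
    x.1 = y.1 ∧ x.2.length + y.2.length = n ∧
    (∀ i, IsIntOfSize M (x.1 i)) ∧
    (∀ s ∈ x.2 ++ y.2, (∀ i, IsIntOfSize M (s.a i)) ∧ IsIntOfSize M s.b) ∧
    ∃ v, LPOptimal x.1 (x.2 ++ y.2) v
  correct x y v := LPOptimal x.1 (x.2 ++ y.2) v

/-!
The lower bound holds for a game with a one-bit answer that two-dimensional linear programs encode.
In the game without rounds the second player holds the bit and the first player, who has to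
announce it, holds nothing. In the `N`-fold lift of a game (`FinGame.lift`), the player who speaks
first holds `N` independent inputs of one side, and the other player holds an index `i` and one input
of the other side; the game is played on the `i`-th of the `N` inputs, and there the holder of the
index speaks first. The `r`-fold lift (`FinGame.tower`) is played in `r` rounds.

*Round elimination* (`FinGame.wins_lift_le`). A first message of at most `C` bits is sent without
knowledge of `i`, so it hardly helps on the average `i`: omitting it costs at most
`(C + 1) / (lam * N) + lam` in success probability under the uniform distribution, for any
`lam ∈ (0, 1]`. No entropy is needed: for a fixed message the total gain over all indices is a sum of
independent bounded variables with controlled exponential moment, and a union bound runs over the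
at most `2 ^ (C + 1)` messages (`sum_gain_le`). Without rounds nothing beats `1 / 2`, so after `r`
rounds the success probability is at most `1 / 2 + r * ((C + 1) / (lam * N) + lam)`
(`FinGame.wins_tower_le`). With `lam` a small multiple of `1 / r` this is below `2 / 3` unless
`C + 1` is at least of order `N / r ^ 2`.

*Encoding* (`LineEncoding`). Both players hold lines, and the answer can be read off the abscissa at
which the two upper envelopes cross; this is the optimum of "minimize `y` above all lines" once a
shear has separated the slopes of the two players. To lift an encoding, block `i` is added to the
`i`-th tangent of a parabola, at places so far apart that blocks do not interfere
(`LineEncoding.lift`). This widens the range of slopes by a factor `9 * N`, whatever the gap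
between the two players' slopes, so that an initial gap of order `(9 * N) ^ r` survives `r` lifts.
The distance between blocks has to grow by a factor of the order of this gap times `N ^ 2` at each
lift, whence coefficients of size `N ^ O(r ^ 2)`. With `N` close to `n ^ (1 / r)` this is
`n ^ O(r)`, and the number of lines is at most `N ^ r + 1 ≤ n`.

If `n ^ (1 / r)` is bounded, it is enough that some bit must be sent (`one_le_cost`).
-/

/-! ### The lifted games and their strategies -/

/-- One player's behaviour in a protocol once the input is fixed: the next message as a function
of the messages sent so far, and a final one-bit answer as a function of the whole transcript. -/
structure Party where
  msg : List (List Bool) → List Bool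
  out : List (List Bool) → Bool

namespace Party

/-- The behaviour that remains after the transcript `h`. -/
def shift (h : List (List Bool)) (p : Party) : Party where
  msg h' := p.msg (h ++ h')
  out h' := p.out (h ++ h')

theorem shift_nil (p : Party) : p.shift [] = p := rfl

theorem shift_shift (h h' : List (List Bool)) (p : Party) :
    (p.shift h).shift h' = p.shift (h ++ h') := by
  simp [shift, List.append_assoc]

/-- The answer after `k` rounds in which `p` speaks first. The player whose turn it would be after
the last message (the receiver of that message, or `p` itself if `k = 0`) gives the answer. -/
def result : ℕ → Party → Party → Bool
  | 0, p, _ => p.out []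
  | k + 1, p, q => result k (q.shift [p.msg []]) (p.shift [p.msg []])

/-- The number of bits sent in `k` rounds in which `p` speaks first. -/
def bits : ℕ → Party → Party → ℕ
  | 0, _, _ => 0
  | k + 1, p, q => (p.msg []).length + bits k (q.shift [p.msg []]) (p.shift [p.msg []])

end Party

/-- A finite two-party problem with a one-bit answer. The player with input in `S` speaks first. -/
structure FinGame where
  S : Type
  T : Type
  [fintypeS : Fintype S]
  [fintypeT : Fintype T]
  [nonemptyS : Nonempty S]
  [nonemptyT : Nonempty T]
  ans : S → T → Bool

namespace FinGame

attribute [instance] FinGame.fintypeS FinGame.fintypeT FinGame.nonemptyS FinGame.nonemptyT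

/-- The first speaker of the lifted game holds `N` inputs of the second player of `𝒢`; the other
player holds an index `i` and an input of the first player of `𝒢`. They play `𝒢`, with the order of
speaking reversed, on the `i`-th input. -/
def lift (N : ℕ) [NeZero N] (𝒢 : FinGame) : FinGame where
  S := Fin N → 𝒢.T
  T := Fin N × 𝒢.S
  ans s t := 𝒢.ans t.2 (s t.1)

/-- The `k`-fold lift of the game in which the second player holds the answer and the first player
holds nothing. -/
def tower (N : ℕ) [NeZero N] : ℕ → FinGame
  | 0 => { S := Unit, T := Bool, ans := fun _ b => b }
  | k + 1 => (tower N k).lift N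

/-- The number of input pairs on which the strategies `σ` and `τ` find the answer in `k` rounds. -/
noncomputable def wins (𝒢 : FinGame) (k : ℕ) (σ : 𝒢.S → Party) (τ : 𝒢.T → Party) : ℝ :=
  ∑ s, ∑ t, if Party.result k (σ s) (τ t) = 𝒢.ans s t then (1 : ℝ) else 0

end FinGame

/-! ### Round elimination -/

theorem card_le_of_length_le (C : ℕ) (M : Finset (List Bool)) (hM : ∀ m ∈ M, m.length ≤ C) :
    M.card ≤ 2 ^ (C + 1) := by
  classical
  have hsub : M ⊆ (Finset.range (C + 1)).biUnion
      (fun k => (Finset.univ : Finset (List.Vector Bool k)).image List.Vector.toList) := by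
    intro m hm
    simp only [Finset.mem_biUnion, Finset.mem_range, Finset.mem_image, Finset.mem_univ, true_and]
    exact ⟨m.length, Nat.lt_succ_of_le (hM m hm), ⟨m, rfl⟩, rfl⟩
  calc M.card ≤ _ := Finset.card_le_card hsub
    _ ≤ ∑ k ∈ Finset.range (C + 1), 2 ^ k := by
      refine Finset.card_biUnion_le.trans (Finset.sum_le_sum fun k _ => ?_)
      refine Finset.card_image_le.trans ?_
      simp
    _ ≤ 2 ^ (C + 1) := (Nat.geomSum_lt (le_refl 2) (by simp)).le

/-- A function with values in `[0, 1]`, centred at its mean under the uniform distribution, is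
subgaussian: its exponential moment at `lam` is at most `exp (lam ^ 2)`. -/
theorem sum_exp_centered_le {A : Type*} [Fintype A] [Nonempty A] (g : A → ℝ)
    (h0 : ∀ a, 0 ≤ g a) (h1 : ∀ a, g a ≤ 1) {lam : ℝ} (hl0 : 0 ≤ lam) (hl1 : lam ≤ 1) :
    ∑ a, Real.exp (lam * (g a - (∑ b, g b) / Fintype.card A)) ≤
      Fintype.card A * Real.exp (lam ^ 2) := by
  set c : ℝ := (Fintype.card A : ℝ) with hc
  have hcpos : 0 < c := by rw [hc]; exact_mod_cast Fintype.card_pos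
  set e := (∑ b, g b) / c with he
  have hsum : ∑ b, g b = c * e := by rw [he]; field_simp
  have he0 : 0 ≤ e := div_nonneg (Finset.sum_nonneg fun a _ => h0 a) hcpos.le
  have he1 : e ≤ 1 := by
    rw [he, div_le_one hcpos]
    calc ∑ b, g b ≤ ∑ _b : A, (1 : ℝ) := Finset.sum_le_sum fun a _ => h1 a
      _ = c := by simp [hc]
  have hpt : ∀ a, Real.exp (lam * (g a - e)) ≤ 1 + lam * (g a - e) + lam ^ 2 := by
    intro a
    have hz : |g a - e| ≤ 1 := by
      rw [abs_le]; constructor <;> linarith [h0 a, h1 a]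
    have hlz : |lam * (g a - e)| ≤ lam := by
      rw [abs_mul, abs_of_nonneg hl0]
      exact mul_le_of_le_one_right hl0 hz
    have h := (abs_le.mp (Real.abs_exp_sub_one_sub_id_le (hlz.trans hl1))).2
    have hsq : (lam * (g a - e)) ^ 2 ≤ lam ^ 2 := sq_le_sq.mpr (by rwa [abs_of_nonneg hl0])
    linarith
  calc ∑ a, Real.exp (lam * (g a - e)) ≤ ∑ a, (1 + lam * (g a - e) + lam ^ 2) :=
        Finset.sum_le_sum fun a _ => hpt a
    _ = c * (lam ^ 2 + 1) := by
        simp only [Finset.sum_add_distrib, ← Finset.mul_sum, Finset.sum_sub_distrib, hsum]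
        simp [← hc]
        ring
    _ ≤ c * Real.exp (lam ^ 2) := by
        gcongr
        exact Real.add_one_le_exp _

/-- A short message about `N` independent uniform samples says little about most of them. Suppose
that `msg x` takes at most `exp L` values and that, for each value `m` and each coordinate `i`, the
gain `g m i : A → [0, 1]` has mean at most `s`. Then a uniform `x` gains at most
`s + L / (lam * N) + lam` from its own message on the average coordinate, for each `lam ∈ (0, 1]`.
The reason is that the exponential moment of the centred total gain for a fixed message is at most
`exp (lam ^ 2 * N)`, and a union bound over the messages multiplies this by at most `exp L`. -/
theorem sum_gain_le {A Msg : Type*} [Fintype A] [Nonempty A] [DecidableEq Msg] {N : ℕ} [NeZero N]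
    (msg : (Fin N → A) → Msg) (g : Msg → Fin N → A → ℝ)
    (h0 : ∀ m i a, 0 ≤ g m i a) (h1 : ∀ m i a, g m i a ≤ 1) {s L lam : ℝ}
    (hs : ∀ x i, ∑ a, g (msg x) i a ≤ s * Fintype.card A)
    (hL : ((Finset.univ.image msg).card : ℝ) ≤ Real.exp L) (hl0 : 0 < lam) (hl1 : lam ≤ 1) :
    ∑ x : Fin N → A, ∑ i, g (msg x) i (x i) ≤
      (s + (L / (lam * N) + lam)) * ((Fintype.card A : ℝ) ^ N * N) := by
  set c : ℝ := (Fintype.card A : ℝ) with hc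
  have hcpos : 0 < c := by rw [hc]; exact_mod_cast Fintype.card_pos
  have hN : (0 : ℝ) < N := by exact_mod_cast Nat.pos_of_ne_zero (NeZero.ne N)
  set e : Msg → Fin N → ℝ := fun m i => (∑ b, g m i b) / c with he
  set Z : Msg → (Fin N → A) → ℝ := fun m x => lam * ∑ i, (g m i (x i) - e m i) with hZ
  have hmom : ∀ m, ∑ x : Fin N → A, Real.exp (Z m x) ≤ c ^ N * Real.exp (lam ^ 2 * N) := by
    intro m
    have hprod : ∑ x : Fin N → A, Real.exp (Z m x) =
        ∏ i : Fin N, ∑ a, Real.exp (lam * (g m i a - e m i)) := by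
      rw [Finset.prod_univ_sum, Fintype.piFinset_univ]
      refine Finset.sum_congr rfl fun x _ => ?_
      rw [← Real.exp_sum, ← Finset.mul_sum]
    rw [hprod]
    calc _ ≤ ∏ _i : Fin N, (c * Real.exp (lam ^ 2)) := by
          refine Finset.prod_le_prod (fun i _ => Finset.sum_nonneg fun a _ => (Real.exp_pos _).le)
            fun i _ => ?_
          exact sum_exp_centered_le (g m i) (h0 m i) (h1 m i) hl0.le hl1
      _ = c ^ N * Real.exp (lam ^ 2 * N) := by
          rw [Finset.prod_const, Finset.card_univ, Fintype.card_fin, mul_pow, ← Real.exp_nat_mul,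
            mul_comm (N : ℝ)]
  have hunion : ∑ x : Fin N → A, Real.exp (Z (msg x) x) ≤
      c ^ N * Real.exp (L + lam ^ 2 * N) := by
    calc ∑ x : Fin N → A, Real.exp (Z (msg x) x)
        ≤ ∑ x : Fin N → A, ∑ m ∈ Finset.univ.image msg, Real.exp (Z m x) := by
          refine Finset.sum_le_sum fun x _ => ?_
          exact Finset.single_le_sum (f := fun m => Real.exp (Z m x))
            (fun m _ => (Real.exp_pos _).le) (Finset.mem_image_of_mem msg (Finset.mem_univ x))
      _ = ∑ m ∈ Finset.univ.image msg, ∑ x : Fin N → A, Real.exp (Z m x) := Finset.sum_comm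
      _ ≤ ∑ _m ∈ Finset.univ.image msg, c ^ N * Real.exp (lam ^ 2 * N) :=
          Finset.sum_le_sum fun m _ => hmom m
      _ = (Finset.univ.image msg).card * (c ^ N * Real.exp (lam ^ 2 * N)) := by
          rw [Finset.sum_const, nsmul_eq_mul]
      _ ≤ Real.exp L * (c ^ N * Real.exp (lam ^ 2 * N)) := by gcongr
      _ = c ^ N * Real.exp (L + lam ^ 2 * N) := by rw [Real.exp_add]; ring
  -- Jensen's inequality for `exp`, by way of the tangent line at `q`.
  set q := L + lam ^ 2 * N with hq
  have hcard : ∑ _x : Fin N → A, (1 : ℝ) = c ^ N := by simp [hc]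
  have havg : ∑ x : Fin N → A, Z (msg x) x ≤ c ^ N * q := by
    have hpt : ∀ x : Fin N → A,
        Z (msg x) x ≤ Real.exp (Z (msg x) x) * Real.exp (-q) + (q - 1) * 1 := by
      intro x
      have := Real.add_one_le_exp (Z (msg x) x + -q)
      rw [Real.exp_add] at this
      linarith
    calc _ ≤ ∑ x : Fin N → A, (Real.exp (Z (msg x) x) * Real.exp (-q) + (q - 1) * 1) :=
          Finset.sum_le_sum fun x _ => hpt x
      _ = (∑ x : Fin N → A, Real.exp (Z (msg x) x)) * Real.exp (-q) + (q - 1) * c ^ N := by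
          rw [Finset.sum_add_distrib, ← Finset.sum_mul, ← Finset.mul_sum, hcard]
      _ ≤ c ^ N * Real.exp q * Real.exp (-q) + (q - 1) * c ^ N := by gcongr
      _ = c ^ N * q := by rw [mul_assoc, ← Real.exp_add]; simp; ring
  have hgZ : ∀ x : Fin N → A,
      lam * ∑ i, g (msg x) i (x i) ≤ Z (msg x) x + lam * (N * s) * 1 := by
    intro x
    have hes : ∑ i, e (msg x) i ≤ N * s := by
      calc ∑ i, e (msg x) i ≤ ∑ _i : Fin N, s := by
            refine Finset.sum_le_sum fun i _ => ?_
            rw [he]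
            exact (div_le_iff₀ hcpos).2 (hs x i)
        _ = N * s := by simp
    simp only [hZ, Finset.sum_sub_distrib]
    nlinarith
  have hfin : lam * ∑ x : Fin N → A, ∑ i, g (msg x) i (x i) ≤
      c ^ N * q + lam * (N * s) * c ^ N := by
    rw [Finset.mul_sum]
    calc _ ≤ ∑ x : Fin N → A, (Z (msg x) x + lam * (N * s) * 1) :=
          Finset.sum_le_sum fun x _ => hgZ x
      _ = ∑ x : Fin N → A, Z (msg x) x + lam * (N * s) * c ^ N := by
          rw [Finset.sum_add_distrib]
          congr 1
          rw [← Finset.mul_sum, hcard]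
      _ ≤ _ := by gcongr
  refine le_of_mul_le_mul_left (hfin.trans (le_of_eq ?_)) hl0
  rw [hq]
  field_simp
  ring

/-- Round elimination. If at most a fraction `s` of the inputs of `𝒢` can be won with `k` rounds
and `C` bits, then at most a fraction `s + (C + 1) / (lam * N) + lam` of the inputs of the lifted
game can be won with `k + 1` rounds and `C` bits. For a first message `m` and an index `i`, the
players can solve `𝒢` on `(t, a)` without the first message: the first speaker completes `a` to
the best block vector that has the `i`-th entry `a` and causes the message `m`. -/
theorem FinGame.wins_lift_le (𝒢 : FinGame) (N : ℕ) [NeZero N] (k C : ℕ) {s lam : ℝ}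
    (hl0 : 0 < lam) (hl1 : lam ≤ 1)
    (H : ∀ (σ : 𝒢.S → Party) (τ : 𝒢.T → Party), (∀ s t, Party.bits k (σ s) (τ t) ≤ C) →
      𝒢.wins k σ τ ≤ s * (Fintype.card 𝒢.S * Fintype.card 𝒢.T))
    (σ : (𝒢.lift N).S → Party) (τ : (𝒢.lift N).T → Party)
    (hC : ∀ s t, Party.bits (k + 1) (σ s) (τ t) ≤ C) :
    (𝒢.lift N).wins (k + 1) σ τ ≤ (s + ((C + 1) / (lam * N) + lam)) *
      (Fintype.card (𝒢.lift N).S * Fintype.card (𝒢.lift N).T) := by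
  classical
  change (Fin N → 𝒢.T) → Party at σ
  change Fin N × 𝒢.S → Party at τ
  set msg : (Fin N → 𝒢.T) → List Bool := fun x => (σ x).msg [] with hmsg
  set R : ℝ := (Fintype.card 𝒢.S : ℝ) with hR
  have hRpos : 0 < R := by rw [hR]; exact_mod_cast Fintype.card_pos
  -- `score m i a x`: the fraction of `t` for which the players succeed if `x` is played for `a`
  -- after the message `m`.
  set score : List Bool → Fin N → 𝒢.T → (Fin N → 𝒢.T) → ℝ := fun m i a x =>
    (∑ t, if Party.result k ((τ (i, t)).shift [m]) ((σ x).shift [m]) = 𝒢.ans t a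
      then (1 : ℝ) else 0) / R with hscore
  have hscore0 : ∀ m i a x, 0 ≤ score m i a x := by
    intro m i a x
    refine div_nonneg (Finset.sum_nonneg fun t _ => ?_) hRpos.le
    split_ifs <;> norm_num
  have hscore1 : ∀ m i a x, score m i a x ≤ 1 := by
    intro m i a x
    rw [hscore, div_le_one hRpos]
    calc _ ≤ ∑ _t : 𝒢.S, (1 : ℝ) := by
          refine Finset.sum_le_sum fun t _ => ?_
          split_ifs <;> norm_num
      _ = R := by simp [hR]
  have hbest : ∀ m, ∀ (i : Fin N) (a : 𝒢.T), ∃ x, ((∃ x0, msg x0 = m) → msg x = m) ∧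
      ∀ x', msg x' = m → x' i = a → score m i a x' ≤ score m i a x := by
    intro m i a
    by_cases hex : ∃ x, msg x = m ∧ x i = a
    · obtain ⟨x0, hx0⟩ := hex
      obtain ⟨x, hx, hmax⟩ := Finset.exists_max_image
        (Finset.univ.filter fun x : Fin N → 𝒢.T => msg x = m ∧ x i = a) (score m i a)
        ⟨x0, by simpa using hx0⟩
      simp only [Finset.mem_filter, Finset.mem_univ, true_and] at hx hmax
      exact ⟨x, fun _ => hx.1, fun x' h1 h2 => hmax x' ⟨h1, h2⟩⟩
    · by_cases hm : ∃ x0, msg x0 = m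
      · obtain ⟨x0, hx0⟩ := hm
        exact ⟨x0, fun _ => hx0, fun x' h1 h2 => (hex ⟨x', h1, h2⟩).elim⟩
      · exact ⟨Classical.arbitrary _, fun h => (hm h).elim,
          fun x' h1 h2 => (hex ⟨x', h1, h2⟩).elim⟩
  choose best hbest1 hbest2 using hbest
  have hs : ∀ (x : Fin N → 𝒢.T) i, ∑ a, score (msg x) i a (best (msg x) i a) ≤
      s * Fintype.card 𝒢.T := by
    intro x i
    have h := H (fun t => (τ (i, t)).shift [msg x])
      (fun a => (σ (best (msg x) i a)).shift [msg x]) (by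
        intro t a
        have h2 := hC (best (msg x) i a) (i, t)
        have h3 : (σ (best (msg x) i a)).msg [] = msg x := hbest1 (msg x) i a ⟨x, rfl⟩
        rw [Party.bits, h3] at h2
        exact le_trans (Nat.le_add_left _ _) h2)
    rw [FinGame.wins, Finset.sum_comm] at h
    simp only [hscore]
    rw [← Finset.sum_div, div_le_iff₀ hRpos]
    exact h.trans (le_of_eq (by ring))
  have hlen : ∀ m ∈ Finset.univ.image msg, m.length ≤ C := by
    intro m hm
    obtain ⟨x, -, rfl⟩ := Finset.mem_image.1 hm
    have h2 := hC x (Classical.arbitrary (Fin N × 𝒢.S))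
    rw [Party.bits] at h2
    exact le_trans (Nat.le_add_right _ _) h2
  have hL : ((Finset.univ.image msg).card : ℝ) ≤ Real.exp ((C : ℝ) + 1) := by
    have h1 : ((Finset.univ.image msg).card : ℝ) ≤ 2 ^ (C + 1) := by
      exact_mod_cast card_le_of_length_le C _ hlen
    refine h1.trans ?_
    have h2 : (2 : ℝ) ≤ Real.exp 1 := by linarith [Real.add_one_le_exp (1 : ℝ)]
    calc (2 : ℝ) ^ (C + 1) ≤ Real.exp 1 ^ (C + 1) := by gcongr
      _ = Real.exp ((C : ℝ) + 1) := by rw [← Real.exp_nat_mul]; push_cast; simp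
  have hmain := sum_gain_le (A := 𝒢.T) msg (fun m i a => score m i a (best m i a))
    (fun m i a => hscore0 _ _ _ _) (fun m i a => hscore1 _ _ _ _) hs hL hl0 hl1
  have hwins : (𝒢.lift N).wins (k + 1) σ τ =
      R * ∑ x : Fin N → 𝒢.T, ∑ i, score (msg x) i (x i) x := by
    rw [Finset.mul_sum]
    change ∑ x : Fin N → 𝒢.T, ∑ t : Fin N × 𝒢.S, _ = _
    refine Finset.sum_congr rfl fun x _ => ?_
    rw [Fintype.sum_prod_type, Finset.mul_sum]
    refine Finset.sum_congr rfl fun i _ => ?_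
    rw [hscore]
    simp only []
    rw [mul_div_cancel₀ _ hRpos.ne']
    rfl
  have hS : (Fintype.card (𝒢.lift N).S : ℝ) = (Fintype.card 𝒢.T : ℝ) ^ N := by
    have : Fintype.card (𝒢.lift N).S = Fintype.card (Fin N → 𝒢.T) :=
      Fintype.card_congr (Equiv.refl _)
    rw [this]; simp
  have hT : (Fintype.card (𝒢.lift N).T : ℝ) = N * R := by
    have : Fintype.card (𝒢.lift N).T = Fintype.card (Fin N × 𝒢.S) :=
      Fintype.card_congr (Equiv.refl _)
    rw [this]; simp [hR]
  rw [hwins, hS, hT]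
  calc R * ∑ x : Fin N → 𝒢.T, ∑ i, score (msg x) i (x i) x
      ≤ R * ∑ x : Fin N → 𝒢.T, ∑ i, score (msg x) i (x i) (best (msg x) i (x i)) := by
        gcongr with x _ i _
        exact hbest2 _ _ _ x rfl rfl
    _ ≤ R * ((s + ((C + 1) / (lam * N) + lam)) * ((Fintype.card 𝒢.T : ℝ) ^ N * N)) := by
        gcongr
    _ = _ := by ring

/-- In `k` rounds with `C` bits, strategies for the `k`-fold lift win at most a fraction
`1 / 2 + k * ((C + 1) / (lam * N) + lam)` of the inputs. -/
theorem FinGame.wins_tower_le (N : ℕ) [NeZero N] (C : ℕ) {lam : ℝ} (hl0 : 0 < lam)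
    (hl1 : lam ≤ 1) (k : ℕ) (σ : (tower N k).S → Party) (τ : (tower N k).T → Party)
    (hC : ∀ s t, Party.bits k (σ s) (τ t) ≤ C) :
    (tower N k).wins k σ τ ≤ (1 / 2 + k * ((C + 1) / (lam * N) + lam)) *
      (Fintype.card (tower N k).S * Fintype.card (tower N k).T) := by
  induction k with
  | zero =>
    have hS : Fintype.card (tower N 0).S = 1 := Fintype.card_congr (Equiv.refl Unit)
    have hT : Fintype.card (tower N 0).T = 2 := Fintype.card_congr (Equiv.refl Bool)
    have hw : (tower N 0).wins 0 σ τ = 1 := by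
      change ∑ s : Unit, ∑ t : Bool, (if (σ s).out [] = t then (1 : ℝ) else 0) = 1
      simp
    rw [hw, hS, hT]
    norm_num
  | succ k ih =>
    refine ((tower N k).wins_lift_le N k C hl0 hl1 ih σ τ hC).trans (le_of_eq ?_)
    change _ = _ * ((Fintype.card ((tower N k).lift N).S : ℝ) *
      Fintype.card ((tower N k).lift N).T)
    push_cast
    ring

/-! ### Encoding the games as linear programs -/

/-- The value at `x` of the line with slope `l.1` and intercept `l.2`. -/
def lineVal (l : ℤ × ℤ) (x : ℤ) : ℤ := l.1 * x + l.2

/-- Two-dimensional linear programs that encode the game `𝒢`. Each player holds lines with integer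
coefficients, and the two upper envelopes cross at an abscissa `opt s t` that determines the answer.
The slopes of the first player are within `w` of `0` and those of the second player are within `w`
of `4 * W`, so that for `w < 2 * W` the crossing is the lowest point above all lines once the linear
function of slope `2 * W` has been subtracted. Intercepts and `opt s t` are bounded by `U`. -/
structure LineEncoding (𝒢 : FinGame) (W w U : ℤ) (numS numT : ℕ) where
  linesS : 𝒢.S → List (ℤ × ℤ)
  linesT : 𝒢.T → List (ℤ × ℤ)
  opt : 𝒢.S → 𝒢.T → ℤ
  height : 𝒢.S → 𝒢.T → ℤ
  length_S : ∀ s, (linesS s).length = numS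
  length_T : ∀ t, (linesT t).length = numT
  slope_S : ∀ s, ∀ l ∈ linesS s, |l.1| ≤ w
  slope_T : ∀ t, ∀ l ∈ linesT t, |4 * W - l.1| ≤ w
  intercept_S : ∀ s, ∀ l ∈ linesS s, |l.2| ≤ U
  intercept_T : ∀ t, ∀ l ∈ linesT t, |l.2| ≤ U
  abs_opt_le : ∀ s t, |opt s t| ≤ U
  below_S : ∀ s t, ∀ l ∈ linesS s, lineVal l (opt s t) ≤ height s t
  below_T : ∀ s t, ∀ l ∈ linesT t, lineVal l (opt s t) ≤ height s t
  tight_S : ∀ s t, ∃ l ∈ linesS s, lineVal l (opt s t) = height s t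
  tight_T : ∀ s t, ∃ l ∈ linesT t, lineVal l (opt s t) = height s t
  ans_eq : ∀ s t s' t', opt s t = opt s' t' → 𝒢.ans s t = 𝒢.ans s' t'

namespace LineEncoding

/-- The line `l`, reflected by `x ↦ -x`, sheared by `4 * W` (which exchanges slopes near `0` and
slopes near `4 * W`), translated by `8 * U * i`, and added to the tangent
`x ↦ 4 * w * i * (2 * x - 8 * U * i)` of a parabola. -/
def place (W w U i : ℤ) (l : ℤ × ℤ) : ℤ × ℤ :=
  (2 * (4 * w) * i + (4 * W - l.1),
    -(4 * w) * (8 * U) * i ^ 2 + l.2 - (4 * W - l.1) * (8 * U * i))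

theorem lineVal_place (W w U i j o : ℤ) (l : ℤ × ℤ) :
    lineVal (place W w U j l) (8 * U * i - o) =
      4 * w * j * (2 * (8 * U * i - o) - 8 * U * j) + (4 * W - l.1) * (8 * U * (i - j) - o)
        + l.2 := by
  simp only [lineVal, place]
  ring

theorem lineVal_place_self (W w U i o : ℤ) (l : ℤ × ℤ) :
    lineVal (place W w U i l) (8 * U * i - o) =
      4 * w * i * (2 * (8 * U * i - o) - 8 * U * i) - 4 * W * o + lineVal l o := by
  simp only [lineVal, place]
  ring

/-- Near its own block, a line of block `i` lies above the lines of the other blocks, because the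
tangents of the parabola are far apart there. -/
theorem lineVal_place_le {W w U i j o : ℤ} {l l' : ℤ × ℤ} (hw : 1 ≤ w) (hU : 1 ≤ U)
    (ho : |o| ≤ U) (hs : |4 * W - l.1| ≤ w) (hs' : |4 * W - l'.1| ≤ w) (hb : |l.2| ≤ U)
    (hb' : |l'.2| ≤ U) (hij : j ≠ i) :
    lineVal (place W w U j l) (8 * U * i - o) ≤ lineVal (place W w U i l') (8 * U * i - o) := by
  rw [lineVal_place, lineVal_place]
  have hw0 : 0 ≤ w := by omega
  obtain ⟨d, rfl⟩ : ∃ d, i = j + d := ⟨i - j, by ring⟩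
  have hd : d ≠ 0 := by rintro rfl; simp at hij
  have hd1 : 1 ≤ |d| := Int.one_le_abs hd
  set σ := 4 * W - l.1
  set σ' := 4 * W - l'.1
  have hod : |d * o| ≤ |d| * U := by rw [abs_mul]; gcongr
  have hσd : |σ * d| ≤ w * |d| := by rw [abs_mul]; gcongr
  have hσo : |σ * o| ≤ w * U := by rw [abs_mul]; gcongr
  have hσo' : |σ' * o| ≤ w * U := by rw [abs_mul]; gcongr
  have hdd : d * d = |d| * |d| := (abs_mul_abs_self d).symm
  have key : 4 * w * (8 * U * (d * d) - 2 * (d * o)) + (σ * o - σ' * o) - 8 * U * (σ * d)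
      + (l'.2 - l.2) ≥ 0 := by
    have h1 := (abs_le.mp hod).2
    have h2 := (abs_le.mp hσd).2
    have h3 := (abs_le.mp hσo).1
    have h4 := (abs_le.mp hσo').2
    have h5 := (abs_le.mp hb).2
    have h6 := (abs_le.mp hb').1
    have e1 : |d| ≤ d * d := by rw [hdd]; nlinarith
    have e2 : w * (d * o) ≤ w * (|d| * U) := by gcongr
    have e3 : U * (σ * d) ≤ U * (w * |d|) := by gcongr
    have e4 : w * (U * |d|) ≤ w * (U * (d * d)) := by gcongr
    have e5 : w * U * 1 ≤ w * U * |d| := by gcongr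
    have e6 : U * 1 ≤ U * w := by gcongr
    nlinarith
  linarith [key]

theorem abs_place_slope_le {W w U i : ℤ} {N : ℕ} [NeZero N] {l : ℤ × ℤ} {g : ℤ} (hw : 0 ≤ w)
    (hi0 : 0 ≤ i) (hiN : i < N) (hs : |4 * W - l.1 - g| ≤ w) :
    |(place W w U i l).1 - g| ≤ 9 * N * w := by
  have h := abs_le.mp hs
  have hN : (1 : ℤ) ≤ N := by exact_mod_cast Nat.pos_of_ne_zero (NeZero.ne N)
  simp only [place]
  have h1 : w * i ≤ w * N := by gcongr
  have h2 : 0 ≤ w * i := by positivity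
  have h3 : w * 1 ≤ w * N := by gcongr
  rw [abs_le]
  constructor <;> nlinarith

theorem abs_place_intercept_le {W w U i : ℤ} {N : ℕ} [NeZero N] {l : ℤ × ℤ} (hw : 0 ≤ w)
    (hW : 1 ≤ W) (hwW : w ≤ W) (hU : 1 ≤ U) (hi0 : 0 ≤ i) (hiN : i < N)
    (hs : |4 * W - l.1| ≤ 5 * W) (hb : |l.2| ≤ U) :
    |(place W w U i l).2| ≤ 100 * W * N ^ 2 * U := by
  have hN : (1 : ℤ) ≤ N := by exact_mod_cast Nat.pos_of_ne_zero (NeZero.ne N)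
  have hb' := abs_le.mp hb
  simp only [place]
  have h1 : |(4 * W - l.1) * (8 * U * i)| ≤ 5 * W * (8 * U * N ^ 2) := by
    rw [abs_mul, abs_of_nonneg (a := 8 * U * i) (by positivity)]
    have : i ≤ (N : ℤ) ^ 2 := by nlinarith
    gcongr
  have h2 : 4 * w * (8 * U) * i ^ 2 ≤ 4 * W * (8 * U) * N ^ 2 := by gcongr
  have h3 : 0 ≤ 4 * w * (8 * U) * i ^ 2 := by positivity
  have h4 : 1 * U ≤ (W * N ^ 2) * U := by
    gcongr
    nlinarith [mul_pos (lt_of_lt_of_le one_pos hW) (pow_pos (lt_of_lt_of_le one_pos hN) 2)]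
  have h1' := abs_le.mp h1
  rw [abs_le]
  constructor <;> nlinarith

/-- An encoding of `𝒢` gives one of the lifted game. The lines of the `i`-th block are placed along
the `i`-th tangent of a parabola; the other player places the lines of the input to `𝒢` along the
tangent that belongs to the index, where only that block matters. -/
def lift {𝒢 : FinGame} {W w U : ℤ} {numS numT : ℕ} (E : LineEncoding 𝒢 W w U numS numT)
    (N : ℕ) [NeZero N] (hw : 1 ≤ w) (hwW : w ≤ W) (hU : 1 ≤ U) :
    LineEncoding (𝒢.lift N) W (9 * N * w) (100 * W * N ^ 2 * U) (N * numT) numS where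
  linesS s := (List.finRange N).flatMap fun i => (E.linesT (s i)).map (place W w U (i : ℕ))
  linesT t := (E.linesS t.2).map (place W w U (t.1 : ℕ))
  opt s t := 8 * U * (t.1 : ℕ) - E.opt t.2 (s t.1)
  height s t := 4 * w * (t.1 : ℕ) * (2 * (8 * U * (t.1 : ℕ) - E.opt t.2 (s t.1))
    - 8 * U * (t.1 : ℕ)) - 4 * W * E.opt t.2 (s t.1) + E.height t.2 (s t.1)
  length_S s := by
    simp [List.length_flatMap, E.length_T]
  length_T t := by simp [E.length_S]
  slope_S s l hl := by
    obtain ⟨i, -, hl⟩ := List.mem_flatMap.1 hl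
    obtain ⟨l, hm, rfl⟩ := List.mem_map.1 hl
    simpa using abs_place_slope_le (N := N) (U := U) (g := 0) (by omega)
      (Int.natCast_nonneg _) (by exact_mod_cast i.2) (by simpa using E.slope_T _ l hm)
  slope_T t l hl := by
    obtain ⟨l, hm, rfl⟩ := List.mem_map.1 hl
    rw [abs_sub_comm]
    exact abs_place_slope_le (by omega) (Int.natCast_nonneg _) (by exact_mod_cast t.1.2)
      (by simpa using E.slope_S _ l hm)
  intercept_S s l hl := by
    obtain ⟨i, -, hl⟩ := List.mem_flatMap.1 hl
    obtain ⟨l, hm, rfl⟩ := List.mem_map.1 hl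
    exact abs_place_intercept_le (by omega) (by omega) hwW hU (Int.natCast_nonneg _)
      (by exact_mod_cast i.2) ((E.slope_T _ l hm).trans (by omega)) (E.intercept_T _ l hm)
  intercept_T t l hl := by
    obtain ⟨l, hm, rfl⟩ := List.mem_map.1 hl
    refine abs_place_intercept_le (by omega) (by omega) hwW hU (Int.natCast_nonneg _)
      (by exact_mod_cast t.1.2) ?_ (E.intercept_S _ l hm)
    have := abs_le.mp (E.slope_S _ l hm)
    rw [abs_le]
    constructor <;> omega
  abs_opt_le s t := by
    have h := abs_le.mp (E.abs_opt_le t.2 (s t.1))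
    have hi : ((t.1 : ℕ) : ℤ) ≤ N := by exact_mod_cast t.1.2.le
    have hN : (1 : ℤ) ≤ N := by exact_mod_cast Nat.pos_of_ne_zero (NeZero.ne N)
    have h1 : U * ((t.1 : ℕ) : ℤ) ≤ U * N := by gcongr
    have h2 : 0 ≤ U * ((t.1 : ℕ) : ℤ) := by positivity
    have h3 : U * 1 ≤ U * N := by gcongr
    have h4 : 1 * (N * 1 * U) ≤ W * (N * N * U) := by
      have hW : 1 ≤ W := by omega
      gcongr
    rw [abs_le]
    constructor <;> nlinarith
  below_S s t l hl := by
    obtain ⟨j, -, hl⟩ := List.mem_flatMap.1 hl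
    obtain ⟨l, hm, rfl⟩ := List.mem_map.1 hl
    by_cases hj : j = t.1
    · subst hj
      rw [lineVal_place_self]
      linarith [E.below_T t.2 _ l hm]
    · obtain ⟨l', hl', h'⟩ := E.tight_T t.2 (s t.1)
      rw [← h', ← lineVal_place_self]
      refine lineVal_place_le hw hU (E.abs_opt_le _ _) (E.slope_T _ l hm)
        (E.slope_T _ l' hl') (E.intercept_T _ l hm) (E.intercept_T _ l' hl') ?_
      intro h
      exact hj (Fin.ext (by exact_mod_cast h))
  below_T s t l hl := by
    obtain ⟨l, hm, rfl⟩ := List.mem_map.1 hl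
    rw [lineVal_place_self]
    linarith [E.below_S t.2 (s t.1) l hm]
  tight_S s t := by
    obtain ⟨l, hl, h⟩ := E.tight_T t.2 (s t.1)
    refine ⟨place W w U (t.1 : ℕ) l, List.mem_flatMap.2 ⟨t.1, List.mem_finRange _,
      List.mem_map_of_mem hl⟩, ?_⟩
    rw [lineVal_place_self, h]
  tight_T s t := by
    obtain ⟨l, hl, h⟩ := E.tight_S t.2 (s t.1)
    refine ⟨place W w U (t.1 : ℕ) l, List.mem_map_of_mem hl, ?_⟩
    rw [lineVal_place_self, h]
  ans_eq s t s' t' h := by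
    have h1 := abs_le.mp (E.abs_opt_le t.2 (s t.1))
    have h2 := abs_le.mp (E.abs_opt_le t'.2 (s' t'.1))
    -- Blocks are `8 * U` apart and each optimum is within `U` of its block, so the indices agree.
    have hi : ((t.1 : ℕ) : ℤ) = (t'.1 : ℕ) := by
      by_contra hne
      rcases lt_or_gt_of_ne hne with hlt | hlt
      · have : U * (((t.1 : ℕ) : ℤ) + 1) ≤ U * (t'.1 : ℕ) := by gcongr; omega
        nlinarith
      · have : U * (((t'.1 : ℕ) : ℤ) + 1) ≤ U * (t.1 : ℕ) := by gcongr; omega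
        nlinarith
    rw [hi] at h
    exact E.ans_eq _ _ _ _ (by linarith)

/-- The encoding of the game without rounds: the horizontal axis and a line of slope `4 * W` that
crosses it at `0` or at `1`. -/
def base (N : ℕ) [NeZero N] {W : ℤ} (hW : 1 ≤ W) :
    LineEncoding (FinGame.tower N 0) W 1 (4 * W) 1 1 where
  linesS _ := [(0, 0)]
  linesT b := [(4 * W, -(4 * W) * Bool.toInt b)]
  opt _ b := Bool.toInt b
  height _ _ := 0
  length_S _ := rfl
  length_T _ := rfl
  slope_S _ l hl := by
    rw [List.mem_singleton.1 hl]; simp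
  slope_T _ l hl := by
    rw [List.mem_singleton.1 hl]; simp
  intercept_S _ l hl := by
    rw [List.mem_singleton.1 hl]; simp; omega
  intercept_T b l hl := by
    change Bool at b
    rw [List.mem_singleton.1 hl, abs_le]
    cases b <;> simp <;> omega
  abs_opt_le _ b := by
    change Bool at b
    rw [abs_le]
    cases b <;> simp <;> omega
  below_S _ _ l hl := by
    rw [List.mem_singleton.1 hl]; simp [lineVal]
  below_T _ b l hl := by
    rw [List.mem_singleton.1 hl]
    simp [lineVal]
  tight_S _ _ := ⟨(0, 0), by simp, by simp [lineVal]⟩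
  tight_T _ b := ⟨_, List.mem_singleton_self _, by simp [lineVal]⟩
  ans_eq _ b _ b' h := by
    change Bool at b b'
    change b = b'
    cases b <;> cases b' <;> simp at h ⊢

/-- The `k`-fold lift has an encoding with at most `N ^ k + 1` lines. -/
theorem exists_tower (N : ℕ) [NeZero N] (r k : ℕ) (hk : k ≤ r) :
    ∃ numS numT : ℕ, numS + numT ≤ N ^ k + 1 ∧
      Nonempty (LineEncoding (FinGame.tower N k) ((9 * N) ^ r) ((9 * N) ^ k)
        ((100 * (9 * N) ^ r * N ^ 2) ^ k * (4 * (9 * N) ^ r)) numS numT) := by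
  have hN : (1 : ℤ) ≤ N := by exact_mod_cast Nat.pos_of_ne_zero (NeZero.ne N)
  have h9 : (1 : ℤ) ≤ 9 * N := by omega
  have hW : (1 : ℤ) ≤ (9 * N) ^ r := one_le_pow₀ h9
  suffices h : ∃ numS numT : ℕ, numS * numT = N ^ k ∧
      Nonempty (LineEncoding (FinGame.tower N k) ((9 * N) ^ r) ((9 * N) ^ k)
        ((100 * (9 * N) ^ r * N ^ 2) ^ k * (4 * (9 * N) ^ r)) numS numT) by
    obtain ⟨a, b, hab, hE⟩ := h
    refine ⟨a, b, ?_, hE⟩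
    have hpos : 0 < a * b := by rw [hab]; exact Nat.pow_pos (Nat.pos_of_ne_zero (NeZero.ne N))
    have ha : 1 ≤ a := Nat.pos_of_mul_pos_right hpos
    have hb : 1 ≤ b := Nat.pos_of_mul_pos_left hpos
    rw [← hab]
    nlinarith
  induction k with
  | zero =>
    refine ⟨1, 1, by simp, ?_⟩
    simpa using ⟨base N hW⟩
  | succ k ih =>
    obtain ⟨a, b, hab, ⟨E⟩⟩ := ih (by omega)
    refine ⟨N * b, a, by rw [pow_succ, ← hab]; ring, ?_⟩
    have hw : (1 : ℤ) ≤ (9 * N) ^ k := one_le_pow₀ h9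
    have hwW : ((9 : ℤ) * N) ^ k ≤ (9 * N) ^ r := pow_le_pow_right₀ h9 (by omega)
    have hU : (1 : ℤ) ≤ (100 * (9 * N) ^ r * N ^ 2) ^ k * (4 * (9 * N) ^ r) := by
      have : (0 : ℤ) < (100 * (9 * N) ^ r * N ^ 2) ^ k * (4 * (9 * N) ^ r) := by positivity
      omega
    have E' := E.lift N hw hwW hU
    have e1 : 9 * (N : ℤ) * (9 * N) ^ k = (9 * N) ^ (k + 1) := by ring
    have e2 : 100 * (9 * (N : ℤ)) ^ r * N ^ 2 *
        ((100 * (9 * N) ^ r * N ^ 2) ^ k * (4 * (9 * N) ^ r)) =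
        (100 * (9 * N) ^ r * N ^ 2) ^ (k + 1) * (4 * (9 * N) ^ r) := by ring
    rw [e1, e2] at E'
    exact ⟨E'⟩

end LineEncoding

/-! ### Protocols as pairs of strategies -/

namespace DetProtocol

variable {X Y Z : Type*}

/-- Alice's behaviour on input `x`. -/
def aliceParty (P : DetProtocol X Y Z) (x : X) : Party where
  msg := P.alice x
  out _ := false

/-- Bob's behaviour on input `y`, with `dec` extracting one bit from his output. -/
def bobParty (P : DetProtocol X Y Z) (dec : Z → Bool) (y : Y) : Party where
  msg := P.bob y
  out h := dec (P.out y h)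

theorem transcript_sub (P : DetProtocol X Y Z) {r k : ℕ} (hk : k + 1 ≤ r) (x : X) (y : Y) :
    P.transcript r x y (r - k) = P.transcript r x y (r - (k + 1)) ++
      [if (k + 1) % 2 = 1 then P.alice x (P.transcript r x y (r - (k + 1)))
        else P.bob y (P.transcript r x y (r - (k + 1)))] := by
  have h1 : r - k = (r - (k + 1)) + 1 := by omega
  have h2 : r - (r - (k + 1)) = k + 1 := by omega
  rw [h1, transcript, h2]

/-- The last `k` of `r` rounds, seen as a conversation in which Alice speaks first if `k` is odd
and Bob speaks first if `k` is even. -/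
theorem result_and_bits_shift (P : DetProtocol X Y Z) (dec : Z → Bool) (r : ℕ) (x : X) (y : Y)
    (k : ℕ) (hk : k ≤ r) :
    Party.result k
        ((if k % 2 = 1 then P.aliceParty x else P.bobParty dec y).shift
          (P.transcript r x y (r - k)))
        ((if k % 2 = 1 then P.bobParty dec y else P.aliceParty x).shift
          (P.transcript r x y (r - k))) = dec (P.output r x y) ∧
      ((P.transcript r x y (r - k)).map List.length).sum + Party.bits k
        ((if k % 2 = 1 then P.aliceParty x else P.bobParty dec y).shift
          (P.transcript r x y (r - k)))
        ((if k % 2 = 1 then P.bobParty dec y else P.aliceParty x).shift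
          (P.transcript r x y (r - k))) = P.cost r x y := by
  induction k with
  | zero => simp [Party.result, Party.bits, Party.shift, bobParty, output, cost]
  | succ k ih =>
    have ih := ih (by omega)
    have ht := P.transcript_sub hk x y
    set h := P.transcript r x y (r - (k + 1)) with hh
    rw [ht] at ih
    rcases Nat.mod_two_eq_zero_or_one k with h0 | h0
    · have h1 : (k + 1) % 2 = 1 := by omega
      have hm : ((P.aliceParty x).shift h).msg [] = P.alice x h := by
        simp [Party.shift, aliceParty]
      simp only [h0, h1, if_true, zero_ne_one, if_false, List.map_append, List.sum_append] at ih
      simp only [h1, if_true, Party.result, Party.bits, hm, Party.shift_shift]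
      simpa [add_assoc] using ih
    · have h1 : (k + 1) % 2 = 0 := by omega
      have hm : ((P.bobParty dec y).shift h).msg [] = P.bob y h := by
        simp [Party.shift, bobParty]
      simp only [h0, h1, if_true, zero_ne_one, if_false, List.map_append, List.sum_append] at ih
      simp only [h1, zero_ne_one, if_false, Party.result, Party.bits, hm, Party.shift_shift]
      simpa [add_assoc] using ih

theorem result_eq (P : DetProtocol X Y Z) (dec : Z → Bool) (r : ℕ) (x : X) (y : Y) :
    Party.result r (if r % 2 = 1 then P.aliceParty x else P.bobParty dec y)
      (if r % 2 = 1 then P.bobParty dec y else P.aliceParty x) = dec (P.output r x y) := by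
  simpa [transcript, Party.shift_nil] using (P.result_and_bits_shift dec r x y r le_rfl).1

theorem bits_eq (P : DetProtocol X Y Z) (dec : Z → Bool) (r : ℕ) (x : X) (y : Y) :
    Party.bits r (if r % 2 = 1 then P.aliceParty x else P.bobParty dec y)
      (if r % 2 = 1 then P.bobParty dec y else P.aliceParty x) = P.cost r x y := by
  simpa [transcript, Party.shift_nil] using (P.result_and_bits_shift dec r x y r le_rfl).2

theorem transcript_length (P : DetProtocol X Y Z) (r : ℕ) (x : X) (y : Y) (i : ℕ) :
    (P.transcript r x y i).length = i := by
  induction i with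
  | zero => rfl
  | succ i ih => simp [transcript, ih]

theorem transcript_of_cost_eq_zero (P : DetProtocol X Y Z) (r : ℕ) (x : X) (y : Y)
    (h : P.cost r x y = 0) : P.transcript r x y r = List.replicate r [] := by
  rw [List.eq_replicate_iff]
  refine ⟨P.transcript_length r x y r, fun m hm => ?_⟩
  rw [cost, List.sum_eq_zero_iff] at h
  exact List.length_eq_zero_iff.1 (h _ (List.mem_map_of_mem hm))

end DetProtocol

/-! ### Averaging over the random string -/

theorem exists_card_le_sum_mem {Ω I : Type*} [MeasurableSpace Ω] [Fintype I] (μ : Measure Ω)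
    [IsProbabilityMeasure μ] (E : I → Set Ω) (hE : ∀ i, MeasurableSet (E i))
    (hμ : ∀ i, 2 / 3 ≤ μ (E i)) :
    ∃ ω, 2 / 3 * (Fintype.card I : ℝ) ≤ ∑ i, (E i).indicator (fun _ => (1 : ℝ)) ω := by
  have hint : ∀ i, Integrable ((E i).indicator (fun _ => (1 : ℝ))) μ := fun i =>
    (integrable_const 1).indicator (hE i)
  obtain ⟨ω, hω⟩ := exists_integral_le (μ := μ)
    (f := fun ω => ∑ i, (E i).indicator (fun _ => (1 : ℝ)) ω)
    (integrable_finsetSum _ fun i _ => hint i)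
  refine ⟨ω, le_trans ?_ hω⟩
  rw [integral_finsetSum _ fun i _ => hint i]
  have hi : ∀ i, (2 / 3 : ℝ) ≤ ∫ ω, (E i).indicator (fun _ => (1 : ℝ)) ω ∂μ := by
    intro i
    rw [integral_indicator (hE i)]
    simp only [integral_const, smul_eq_mul, mul_one, Measure.real]
    have := ENNReal.toReal_mono (measure_ne_top μ (E i)) (hμ i)
    simpa using this
  calc 2 / 3 * (Fintype.card I : ℝ) = ∑ _i : I, (2 / 3 : ℝ) := by simp [mul_comm]
    _ ≤ _ := Finset.sum_le_sum fun i _ => hi i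

/-! ### Linear programs from lines -/

/-- The constraint that `(v 0, v 1)` lies above the line `l` from which the linear function of slope
`2 * W` has been subtracted. -/
def lineConstraint (W : ℤ) (l : ℤ × ℤ) : LinConstraint 2 where
  a := ![(l.1 - 2 * W : ℤ), -1]
  b := (-l.2 : ℤ)

/-- The constraint `0 ≤ 0`. -/
def trivialConstraint : LinConstraint 2 where
  a := 0
  b := 0

/-- The input of a player who holds the lines `L` and `pad` trivial constraints. The objective is
the second coordinate. -/
def lineInput (W : ℤ) (L : List (ℤ × ℤ)) (pad : ℕ) : LPInput 2 :=
  (![0, 1], L.map (lineConstraint W) ++ List.replicate pad trivialConstraint)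

theorem lpFeasible_lineInput_append {W : ℤ} {L L' : List (ℤ × ℤ)} {pad pad' : ℕ} {v : Fin 2 → ℝ} :
    LPFeasible ((lineInput W L pad).2 ++ (lineInput W L' pad').2) v ↔
      ∀ l, l ∈ L ∨ l ∈ L' → ((l.1 : ℝ) - 2 * W) * v 0 + l.2 ≤ v 1 := by
  have hl : ∀ l : ℤ × ℤ, (∑ i, (lineConstraint W l).a i * v i ≤ (lineConstraint W l).b ↔
      ((l.1 : ℝ) - 2 * W) * v 0 + l.2 ≤ v 1) := by
    intro l
    simp only [lineConstraint, Fin.sum_univ_two, Matrix.cons_val_zero, Matrix.cons_val_one]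
    push_cast
    constructor <;> intro h <;> linarith
  have h0 : ∑ i, trivialConstraint.a i * v i ≤ trivialConstraint.b := by
    simp [trivialConstraint]
  constructor
  · intro h l hmem
    refine (hl l).1 (h _ ?_)
    rcases hmem with hmem | hmem
    · exact List.mem_append_left _ (List.mem_append_left _ (List.mem_map_of_mem hmem))
    · exact List.mem_append_right _ (List.mem_append_left _ (List.mem_map_of_mem hmem))
  · intro h c hc
    rcases List.mem_append.1 hc with hc | hc <;> rcases List.mem_append.1 hc with hc | hc
    · obtain ⟨l, hm, rfl⟩ := List.mem_map.1 hc
      exact (hl l).2 (h l (Or.inl hm))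
    · rw [List.eq_of_mem_replicate hc]; exact h0
    · obtain ⟨l, hm, rfl⟩ := List.mem_map.1 hc
      exact (hl l).2 (h l (Or.inr hm))
    · rw [List.eq_of_mem_replicate hc]; exact h0

/-- A point above all lines that lies on a line of negative slope and on a line of positive slope
is the only lowest such point. -/
theorem lpOptimal_lineInput {W : ℤ} {L L' : List (ℤ × ℤ)} {pad pad' : ℕ} {o h : ℤ}
    (hle : ∀ l, l ∈ L ∨ l ∈ L' → lineVal l o ≤ h)
    (hα : ∃ l, (l ∈ L ∨ l ∈ L') ∧ l.1 < 2 * W ∧ lineVal l o = h)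
    (hβ : ∃ l, (l ∈ L ∨ l ∈ L') ∧ 2 * W < l.1 ∧ lineVal l o = h) :
    LPOptimal ![0, 1] ((lineInput W L pad).2 ++ (lineInput W L' pad').2)
        ![(o : ℝ), (h - 2 * W * o : ℝ)] ∧
      ∀ v, LPOptimal ![0, 1] ((lineInput W L pad).2 ++ (lineInput W L' pad').2) v → v 0 = o := by
  obtain ⟨α, hαm, hαs, hαh⟩ := hα
  obtain ⟨β, hβm, hβs, hβh⟩ := hβ
  have hαs' : (α.1 : ℝ) - 2 * W < 0 := by
    have : (α.1 : ℝ) < 2 * W := by exact_mod_cast hαs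
    linarith
  have hβs' : 0 < (β.1 : ℝ) - 2 * W := by
    have : 2 * (W : ℝ) < β.1 := by exact_mod_cast hβs
    linarith
  have hαh' : (α.1 : ℝ) * o + α.2 = h := by exact_mod_cast hαh
  have hβh' : (β.1 : ℝ) * o + β.2 = h := by exact_mod_cast hβh
  have hfeas : LPFeasible ((lineInput W L pad).2 ++ (lineInput W L' pad').2)
      ![(o : ℝ), (h - 2 * W * o : ℝ)] := by
    rw [lpFeasible_lineInput_append]
    intro l hl
    have : (l.1 : ℝ) * o + l.2 ≤ h := by exact_mod_cast hle l hl
    simp only [Matrix.cons_val_zero, Matrix.cons_val_one]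
    linarith
  have hlow : ∀ v : Fin 2 → ℝ, LPFeasible ((lineInput W L pad).2 ++ (lineInput W L' pad').2) v →
      (h - 2 * W * o : ℝ) ≤ v 1 ∧ (v 1 ≤ h - 2 * W * o → v 0 = o) := by
    intro v hv
    rw [lpFeasible_lineInput_append] at hv
    have h1 := hv α hαm
    have h2 := hv β hβm
    rcases lt_trichotomy (v 0) o with hlt | heq | hgt
    · have : 0 < ((α.1 : ℝ) - 2 * W) * (v 0 - o) := mul_pos_of_neg_of_neg hαs' (by linarith)
      exact ⟨by linarith, fun h3 => by linarith⟩
    · rw [heq] at h1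
      exact ⟨by linarith, fun _ => heq⟩
    · have : 0 < ((β.1 : ℝ) - 2 * W) * (v 0 - o) := mul_pos hβs' (by linarith)
      exact ⟨by linarith, fun h3 => by linarith⟩
  refine ⟨⟨hfeas, fun v hv => ?_⟩, fun v hv => ?_⟩
  · simpa [Fin.sum_univ_two] using (hlow v hv).1
  · refine (hlow v hv.1).2 ?_
    simpa [Fin.sum_univ_two] using hv.2 _ hfeas

theorem isIntOfSize_zero (M : ℕ) : IsIntOfSize M 0 := ⟨0, by simp, by simp⟩

theorem isIntOfSize_objective {M : ℕ} (hM : 1 ≤ M) (i : Fin 2) :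
    IsIntOfSize M ((![0, 1] : Fin 2 → ℝ) i) := by
  fin_cases i
  · exact isIntOfSize_zero M
  · exact ⟨1, by simp, by simpa using hM⟩

theorem isIntOfSize_trivialConstraint (M : ℕ) :
    (∀ i, IsIntOfSize M (trivialConstraint.a i)) ∧ IsIntOfSize M trivialConstraint.b :=
  ⟨fun _ => isIntOfSize_zero M, isIntOfSize_zero M⟩

theorem isIntOfSize_lineInput {W : ℤ} {L : List (ℤ × ℤ)} {pad M : ℕ} (hM : 1 ≤ M)
    (hs : ∀ l ∈ L, |l.1 - 2 * W| ≤ M) (hb : ∀ l ∈ L, |l.2| ≤ M) :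
    ∀ c ∈ (lineInput W L pad).2, (∀ i, IsIntOfSize M (c.a i)) ∧ IsIntOfSize M c.b := by
  intro c hc
  rcases List.mem_append.1 hc with hc | hc
  · obtain ⟨l, hl, rfl⟩ := List.mem_map.1 hc
    refine ⟨fun i => ?_, ⟨-l.2, rfl, by simpa using hb l hl⟩⟩
    fin_cases i
    · exact ⟨l.1 - 2 * W, rfl, hs l hl⟩
    · exact ⟨-1, by simp [lineConstraint], by simpa using hM⟩
  · rw [List.eq_of_mem_replicate hc]
    exact isIntOfSize_trivialConstraint M

/-! ### The lower bound -/

/-- A protocol that sends no bits cannot tell the constraint `-v 1 ≤ 0` from `-v 1 ≤ 1`. -/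
theorem one_le_cost {r n M : ℕ} (hn : 1 ≤ n) (hM : 1 ≤ M) {Ω : Type*} [MeasurableSpace Ω]
    (μ : Measure Ω) [IsProbabilityMeasure μ]
    (P : Ω → DetProtocol (LPInput 2) (LPInput 2) (Fin 2 → ℝ)) (C : ℕ)
    (hS : SolvesWithRounds μ P r (lpProblem 2 n M))
    (hC : CostAtMost P r (lpProblem 2 n M) C) : 1 ≤ C := by
  by_contra hlt
  have hC0 : C = 0 := by omega
  subst hC0
  set x : ℤ → LPInput 2 := fun b => lineInput 0 [(0, -b)] (n - 1) with hx
  set y : LPInput 2 := lineInput 0 [] 0 with hy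
  have hfeas : ∀ b v, LPFeasible ((x b).2 ++ y.2) v ↔ ((-b : ℤ) : ℝ) ≤ v 1 := by
    intro b v
    rw [hx, hy, lpFeasible_lineInput_append]
    simp
  have hopt : ∀ b : ℤ, LPOptimal ![0, 1] ((x b).2 ++ y.2) ![0, ((-b : ℤ) : ℝ)] := by
    refine fun b => ⟨(hfeas _ _).2 (by simp), fun v hv => ?_⟩
    simpa [Fin.sum_univ_two] using (hfeas _ _).1 hv
  have huniq : ∀ (b : ℤ) v, LPOptimal ![0, 1] ((x b).2 ++ y.2) v → v 1 = ((-b : ℤ) : ℝ) := by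
    intro b v hv
    refine le_antisymm ?_ ((hfeas _ _).1 hv.1)
    simpa [Fin.sum_univ_two] using hv.2 _ (hopt b).1
  have hvalid : ∀ b : ℤ, |b| ≤ 1 → (lpProblem 2 n M).valid (x b) y := by
    intro b hb
    refine ⟨rfl, ?_, isIntOfSize_objective hM, ?_, _, hopt b⟩
    · simp [hx, hy, lineInput]; omega
    · have hM' : (1 : ℤ) ≤ M := by exact_mod_cast hM
      intro c hc
      rcases List.mem_append.1 hc with hc | hc
      · refine isIntOfSize_lineInput hM ?_ ?_ c hc
        · simp
        · simpa using hb.trans hM'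
      · simp [hy, lineInput] at hc
  have hout : ∀ ω, (P ω).output r (x 0) y = (P ω).output r (x 1) y := by
    intro ω
    have h0 := Nat.le_zero.1 (hC _ _ (hvalid 0 (by simp)) ω)
    have h1 := Nat.le_zero.1 (hC _ _ (hvalid 1 (by simp)) ω)
    rw [DetProtocol.output, DetProtocol.output, DetProtocol.transcript_of_cost_eq_zero _ _ _ _ h0,
      DetProtocol.transcript_of_cost_eq_zero _ _ _ _ h1]
  obtain ⟨E0, hE0, hμ0, hc0⟩ := hS _ _ (hvalid 0 (by simp))
  obtain ⟨E1, hE1, hμ1, hc1⟩ := hS _ _ (hvalid 1 (by simp))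
  have hdisj : Disjoint E0 E1 := by
    rw [Set.disjoint_left]
    intro ω h0 h1
    have e0 := huniq 0 _ (hc0 ω h0)
    have e1 := huniq 1 _ (hc1 ω h1)
    rw [hout, e1] at e0
    norm_num at e0
  have hunion := measure_union (μ := μ) hdisj hE1
  have hle : μ (E0 ∪ E1) ≤ 1 := prob_le_one
  rw [hunion] at hle
  have h43 : (2 / 3 : ENNReal) + 2 / 3 ≤ 1 := (add_le_add hμ0 hμ1).trans hle
  have h43' := ENNReal.toReal_mono ENNReal.one_ne_top h43
  rw [ENNReal.toReal_add (by simp [ENNReal.div_eq_top]) (by simp [ENNReal.div_eq_top])] at h43'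
  norm_num at h43'

/-- A protocol for linear programs that are large enough to encode the `r`-fold lift solves that
game: it finds the answer on two thirds of the inputs for some fixed random string, which the round
elimination bound limits. -/
theorem two_thirds_le {r n N M : ℕ} [NeZero N] (hn : N ^ r + 1 ≤ n)
    (hM : 4 * (9 * N) ^ r * (100 * (9 * N) ^ r * N ^ 2) ^ r ≤ M) {Ω : Type*} [MeasurableSpace Ω]
    (μ : Measure Ω) [IsProbabilityMeasure μ]
    (P : Ω → DetProtocol (LPInput 2) (LPInput 2) (Fin 2 → ℝ)) (C : ℕ)
    (hS : SolvesWithRounds μ P r (lpProblem 2 n M))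
    (hC : CostAtMost P r (lpProblem 2 n M) C) {lam : ℝ} (hl0 : 0 < lam) (hl1 : lam ≤ 1) :
    2 / 3 ≤ 1 / 2 + r * ((C + 1) / (lam * N) + lam) := by
  classical
  obtain ⟨numS, numT, hnum, ⟨E⟩⟩ := LineEncoding.exists_tower N r r le_rfl
  set 𝒢 := FinGame.tower N r with h𝒢
  have hN : 1 ≤ N := Nat.pos_of_ne_zero (NeZero.ne N)
  set W : ℤ := (9 * N) ^ r with hW
  have hWpos : 1 ≤ W := one_le_pow₀ (by omega)
  have hU : (100 * W * N ^ 2) ^ r * (4 * W) ≤ (M : ℤ) := by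
    rw [mul_comm, hW]; exact_mod_cast hM
  have h4W : 4 * W ≤ (M : ℤ) := by
    refine le_trans (le_mul_of_one_le_left (by omega) (one_le_pow₀ ?_)) hU
    have : (1 : ℤ) ≤ N ^ 2 := one_le_pow₀ (by omega)
    nlinarith
  have hM1 : 1 ≤ M := by omega
  set inS : 𝒢.S → LPInput 2 := fun s => lineInput W (E.linesS s) (n - (numS + numT)) with hinS
  set inT : 𝒢.T → LPInput 2 := fun t => lineInput W (E.linesT t) 0 with hinT
  have hszS : ∀ s, ∀ c ∈ (inS s).2, (∀ i, IsIntOfSize M (c.a i)) ∧ IsIntOfSize M c.b := by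
    refine fun s => isIntOfSize_lineInput hM1 (fun l hl => ?_)
      (fun l hl => (E.intercept_S s l hl).trans hU)
    have := abs_le.mp (E.slope_S s l hl)
    rw [abs_le]; constructor <;> omega
  have hszT : ∀ t, ∀ c ∈ (inT t).2, (∀ i, IsIntOfSize M (c.a i)) ∧ IsIntOfSize M c.b := by
    refine fun t => isIntOfSize_lineInput hM1 (fun l hl => ?_)
      (fun l hl => (E.intercept_T t l hl).trans hU)
    have := abs_le.mp (E.slope_T t l hl)
    rw [abs_le]; constructor <;> omega
  -- The first speaker is Alice if `r` is odd and Bob if `r` is even.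
  set xin : 𝒢.S → 𝒢.T → LPInput 2 := fun s t => if r % 2 = 1 then inS s else inT t with hxin
  set yin : 𝒢.S → 𝒢.T → LPInput 2 := fun s t => if r % 2 = 1 then inT t else inS s with hyin
  have hopt : ∀ s t,
      (∃ v, LPOptimal ![0, 1] ((xin s t).2 ++ (yin s t).2) v) ∧
      ∀ v, LPOptimal ![0, 1] ((xin s t).2 ++ (yin s t).2) v → v 0 = E.opt s t := by
    intro s t
    obtain ⟨α, hα, hαh⟩ := E.tight_S s t
    obtain ⟨β, hβ, hβh⟩ := E.tight_T s t
    have hαs : α.1 < 2 * W := by have := abs_le.mp (E.slope_S s α hα); omega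
    have hβs : 2 * W < β.1 := by have := abs_le.mp (E.slope_T t β hβ); omega
    by_cases hr : r % 2 = 1
    · simp only [hxin, hyin, hr, if_true]
      have := lpOptimal_lineInput (W := W) (L := E.linesS s) (L' := E.linesT t)
        (pad := n - (numS + numT)) (pad' := 0) (o := E.opt s t) (h := E.height s t)
        (fun l hl => hl.elim (E.below_S s t l) (E.below_T s t l))
        ⟨α, Or.inl hα, hαs, hαh⟩ ⟨β, Or.inr hβ, hβs, hβh⟩
      exact ⟨⟨_, this.1⟩, this.2⟩
    · simp only [hxin, hyin, hr, if_false]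
      have := lpOptimal_lineInput (W := W) (L := E.linesT t) (L' := E.linesS s)
        (pad := 0) (pad' := n - (numS + numT)) (o := E.opt s t) (h := E.height s t)
        (fun l hl => hl.elim (E.below_T s t l) (E.below_S s t l))
        ⟨α, Or.inr hα, hαs, hαh⟩ ⟨β, Or.inl hβ, hβs, hβh⟩
      exact ⟨⟨_, this.1⟩, this.2⟩
  have hobj : ∀ s t, (xin s t).1 = ![0, 1] ∧ (yin s t).1 = ![0, 1] := by
    intro s t
    by_cases hr : r % 2 = 1 <;> simp [hxin, hyin, hr, hinS, hinT, lineInput]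
  have hvalid : ∀ s t, (lpProblem 2 n M).valid (xin s t) (yin s t) := by
    intro s t
    refine ⟨(hobj s t).1.trans (hobj s t).2.symm, ?_, ?_, ?_, ?_⟩
    · have h1 : (inS s).2.length = numS + (n - (numS + numT)) := by
        simp [hinS, lineInput, E.length_S]
      have h2 : (inT t).2.length = numT := by simp [hinT, lineInput, E.length_T]
      by_cases hr : r % 2 = 1
      · simp only [hxin, hyin, hr, if_true, h1, h2]; omega
      · simp only [hxin, hyin, hr, if_false, h1, h2]; omega
    · rw [(hobj s t).1]
      exact isIntOfSize_objective hM1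
    · intro c hc
      by_cases hr : r % 2 = 1
      · simp only [hxin, hyin, hr, if_true] at hc
        exact (List.mem_append.1 hc).elim (hszS s c) (hszT t c)
      · simp only [hxin, hyin, hr, if_false] at hc
        exact (List.mem_append.1 hc).elim (hszT t c) (hszS s c)
    · rw [(hobj s t).1]
      exact (hopt s t).1
  set dec : (Fin 2 → ℝ) → Bool := fun v =>
    decide (∃ s t, v 0 = E.opt s t ∧ 𝒢.ans s t = true) with hdec
  have hdec_eq : ∀ s t v, (lpProblem 2 n M).correct (xin s t) (yin s t) v →
      dec v = 𝒢.ans s t := by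
    intro s t v hv
    have hv0 : v 0 = E.opt s t := by
      refine (hopt s t).2 v ?_
      have : LPOptimal (xin s t).1 ((xin s t).2 ++ (yin s t).2) v := hv
      rwa [(hobj s t).1] at this
    rw [Bool.eq_iff_iff, hdec, decide_eq_true_iff]
    constructor
    · rintro ⟨s', t', h1, h2⟩
      rw [hv0] at h1
      rw [E.ans_eq s t s' t' (by exact_mod_cast h1), h2]
    · exact fun h => ⟨s, t, hv0, h⟩
  choose A hA hμA hcor using fun st : 𝒢.S × 𝒢.T => hS _ _ (hvalid st.1 st.2)
  obtain ⟨ω, hω⟩ := exists_card_le_sum_mem μ A hA hμA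
  set σ : 𝒢.S → Party := fun s =>
    if r % 2 = 1 then (P ω).aliceParty (inS s) else (P ω).bobParty dec (inS s) with hσ
  set τ : 𝒢.T → Party := fun t =>
    if r % 2 = 1 then (P ω).bobParty dec (inT t) else (P ω).aliceParty (inT t) with hτ
  have hσeq : ∀ s t, σ s = if r % 2 = 1 then (P ω).aliceParty (xin s t)
      else (P ω).bobParty dec (yin s t) := by
    intro s t
    by_cases hr : r % 2 = 1 <;> simp [hσ, hxin, hyin, hr]
  have hτeq : ∀ s t, τ t = if r % 2 = 1 then (P ω).bobParty dec (yin s t)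
      else (P ω).aliceParty (xin s t) := by
    intro s t
    by_cases hr : r % 2 = 1 <;> simp [hτ, hxin, hyin, hr]
  have hwins := FinGame.wins_tower_le N C hl0 hl1 r σ τ (by
    intro s t
    rw [hσeq s t, hτeq s t, DetProtocol.bits_eq]
    exact hC _ _ (hvalid s t) ω)
  have hge : 2 / 3 * ((Fintype.card 𝒢.S : ℝ) * Fintype.card 𝒢.T) ≤ 𝒢.wins r σ τ := by
    rw [Fintype.card_prod, Nat.cast_mul] at hω
    refine hω.trans ?_
    rw [Fintype.sum_prod_type, FinGame.wins]
    refine Finset.sum_le_sum fun s _ => Finset.sum_le_sum fun t _ => ?_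
    by_cases hmem : ω ∈ A (s, t)
    · have h1 : Party.result r (σ s) (τ t) = 𝒢.ans s t := by
        rw [hσeq s t, hτeq s t, DetProtocol.result_eq]
        exact hdec_eq s t _ (hcor (s, t) ω hmem)
      rw [if_pos h1, Set.indicator_of_mem hmem]
    · rw [Set.indicator_of_notMem hmem]
      split_ifs <;> norm_num
  have hpos : (0 : ℝ) < Fintype.card 𝒢.S * Fintype.card 𝒢.T := by
    have h1 : 0 < Fintype.card 𝒢.S := Fintype.card_pos
    have h2 : 0 < Fintype.card 𝒢.T := Fintype.card_pos
    positivity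
  exact le_of_mul_le_mul_right (hge.trans hwins) hpos

theorem coefficient_bound_le {r n N : ℕ} (hr : 1 ≤ r) (hn : N ^ r ≤ n) (h4 : 4 ^ r ≤ n) :
    4 * (9 * N) ^ r * (100 * (9 * N) ^ r * N ^ 2) ^ r ≤ n ^ (13 * r) := by
  have h4n : 4 ≤ n := le_trans (Nat.le_self_pow (by omega) 4) h4
  have h9 : 9 ^ r ≤ n ^ 2 :=
    calc 9 ^ r ≤ (4 ^ 2) ^ r := Nat.pow_le_pow_left (by norm_num) r
      _ = (4 ^ r) ^ 2 := by rw [← pow_mul, ← pow_mul, mul_comm]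
      _ ≤ n ^ 2 := Nat.pow_le_pow_left h4 2
  have h100 : 100 ^ r ≤ n ^ 4 :=
    calc 100 ^ r ≤ (4 ^ 4) ^ r := Nat.pow_le_pow_left (by norm_num) r
      _ = (4 ^ r) ^ 4 := by rw [← pow_mul, ← pow_mul, mul_comm]
      _ ≤ n ^ 4 := Nat.pow_le_pow_left h4 4
  have hW : (9 * N) ^ r ≤ n ^ 3 :=
    calc (9 * N) ^ r = 9 ^ r * N ^ r := mul_pow _ _ _
      _ ≤ n ^ 2 * n := Nat.mul_le_mul h9 hn
      _ = n ^ 3 := by ring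
  generalize (9 * N) ^ r = V at hW ⊢
  calc 4 * V * (100 * V * N ^ 2) ^ r = 4 * V * (100 ^ r * V ^ r * (N ^ r) ^ 2) := by
        rw [mul_pow, mul_pow, ← pow_mul N, ← pow_mul N, mul_comm 2 r]
    _ ≤ n * n ^ 3 * (n ^ 4 * (n ^ 3) ^ r * n ^ 2) := by gcongr
    _ = n ^ (10 + 3 * r) := by rw [← pow_mul]; ring
    _ ≤ n ^ (13 * r) := Nat.pow_le_pow_right (by omega) (by omega)

theorem mainTheorem2 :
    ∃ (c : ℝ) (K : ℕ), 0 < c ∧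
      ∀ (r n : ℕ), 1 ≤ r →
      ∀ (Ω : Type*) [MeasurableSpace Ω] (μ : Measure Ω) [IsProbabilityMeasure μ]
        (P : Ω → DetProtocol (LPInput 2) (LPInput 2) (Fin 2 → ℝ)) (C : ℕ),
        SolvesWithRounds μ P r (lpProblem 2 n (n ^ (K * r))) →
        CostAtMost P r (lpProblem 2 n (n ^ (K * r))) C →
        c * ((n : ℝ) ^ ((1 : ℝ) / (r : ℝ)) / (r : ℝ) ^ 2) ≤ (C : ℝ) := by
  refine ⟨1 / 576, 13, by norm_num, fun r n hr Ω _ μ _ P C hS hC => ?_⟩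
  have hr1 : (1 : ℝ) ≤ r := by exact_mod_cast hr
  have hr0 : (0 : ℝ) < r := by linarith
  have hrr : (1 : ℝ) ≤ (r : ℝ) ^ 2 := one_le_pow₀ hr1
  rcases Nat.eq_zero_or_pos n with rfl | hn
  · rw [Nat.cast_zero, Real.zero_rpow (by positivity)]
    simp
  have hC1 : (1 : ℝ) ≤ C := by
    exact_mod_cast one_le_cost hn (Nat.one_le_pow _ _ hn) μ P C hS hC
  set q : ℝ := (n : ℝ) ^ ((1 : ℝ) / (r : ℝ)) with hq
  have hq0 : 0 ≤ q := by positivity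
  have hqr : q ^ r = n := by
    rw [hq, one_div]
    exact Real.rpow_inv_natCast_pow (by positivity) (by omega)
  rcases lt_or_ge q 4 with hlt | hge
  · have : q / (r : ℝ) ^ 2 ≤ q := div_le_self hq0 hrr
    linarith
  obtain ⟨N, hN⟩ : ∃ N, ⌊q⌋₊ = N + 1 := Nat.exists_eq_succ_of_ne_zero (by
    have : 4 ≤ ⌊q⌋₊ := Nat.le_floor (by exact_mod_cast hge)
    omega)
  have hNq : (N : ℝ) + 1 ≤ q := by
    have := Nat.floor_le hq0
    rw [hN] at this
    exact_mod_cast this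
  have hqN : q < N + 2 := by
    have := Nat.lt_floor_add_one q
    rw [hN] at this
    push_cast at this
    linarith
  have hN2 : q / 2 ≤ N := by linarith
  have hN0 : (0 : ℝ) < N := by linarith
  have : NeZero N := ⟨by rintro rfl; simp at hN0⟩
  have h4 : 4 ^ r ≤ n := by
    have : (4 : ℝ) ^ r ≤ n := by rw [← hqr]; gcongr
    exact_mod_cast this
  have hNn : N ^ r + 1 ≤ n := by
    have h1 : (N + 1) ^ r ≤ n := by
      have : ((N : ℝ) + 1) ^ r ≤ n := by rw [← hqr]; gcongr
      exact_mod_cast this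
    have h2 : N ^ r < (N + 1) ^ r := Nat.pow_lt_pow_left (Nat.lt_succ_self N) (by omega)
    omega
  -- The choice of `lam` makes the loss `r * lam` half of the gap between `1 / 2` and `2 / 3`.
  have hmain := two_thirds_le hNn (coefficient_bound_le hr (by omega) h4) μ P C hS hC
    (lam := 1 / (12 * r)) (by positivity) (by
      rw [div_le_one (by positivity)]
      linarith)
  have hgap : (N : ℝ) ≤ 144 * r ^ 2 * (C + 1) := by
    have e : (r : ℝ) * (((C : ℝ) + 1) / (1 / (12 * r) * N) + 1 / (12 * r)) =
        12 * r ^ 2 * (C + 1) / N + 1 / 12 := by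
      field_simp
    rw [e] at hmain
    have h1 : 1 / 12 ≤ 12 * (r : ℝ) ^ 2 * (C + 1) / N := by linarith
    rw [le_div_iff₀ hN0] at h1
    linarith
  have hfin : q ≤ 576 * r ^ 2 * C := by nlinarith
  rw [← mul_div_assoc, div_le_iff₀ (by positivity)]
  linarith
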